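/- Let $a\in\mathbb R$, $b>0$ and $g\in L^2(\mathbb R)$ (complex-valued). For $m,n\in\mathbb Z$ put $g_{m,n}(t)=e^{2\pi i m b t}g(t-na)$, and for $k\in\mathbb Z$ put $$G_k(t)=\sum_{n\in\mathbb Z} g(t-na)\,\overline{g(t-na-k/b)},\qquad\text{so that}\qquad G_0(t)=\sum_{n\in\mathbb Z}|g(t-na)|^2 .$$ Assume that there is a real constant $B$ with $G_0(t)\le B$ for almost every $t\in\mathbb R$ (this includes finiteness of the sum). For $f\in L^2(\mathbb R)$ and $K\ge 0$ let $$S_Kf(t)=\sum_{k=-K}^{K} f(t-k/b)\,G_k(t)\ \in L^2(\mathbb R)$$ be the symmetric partial sums of the Walnut series of $f$, and let $$Sf=\sum_{m,n\in\mathbb Z}\langle f,g_{m,n}\rangle\, g_{m,n}$$ whenever this series converges unconditionally in $L^2(\mathbb R)$. The inner product is linear in its first argument. The following are equivalent: (1) For every $f\in L^2(\mathbb R)$ the Walnut series converges symmetrically in norm, that is, $\lim_{K\to\infty}S_Kf$ exists in the norm of $L^2(\mathbb R)$. (2) For every $f\in L^2(\mathbb R)$, $Sf$ is defined and $$\lim_{K\to\infty}\frac1b\langle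 S_Kf,f\rangle=\langle Sf,f\rangle .$$ (3) For every $f\in L^2(\mathbb R)$ the WH-frame identity holds with its right-hand side summed symmetrically, that is, $$\sum_{m,n\in\mathbb Z}|\langle f,g_{m,n}\rangle|^2=\lim_{K\to\infty}\frac1b\sum_{k=-K}^{K}\int_{\mathbb R}\overline{f(t)}\,f(t-k/b)\,G_k(t)\,dt ,$$ where the left-hand side is finite and the limit exists. -/

import Mathlib

open MeasureTheory Filter Topology
open scoped ENNReal ComplexConjugate

noncomputable section

namespace WHFrame

/-- The complex Hilbert space `L²(ℝ)` (Lebesgue measure). -/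
abbrev L2R : Type := Lp ℂ 2 (volume : Measure ℝ)

/-- Translation `T_a f (x) = f (x - a)`, as a linear isometry of `L²(ℝ)`. -/
def translation (a : ℝ) : L2R →ₗᵢ[ℂ] L2R :=
  Lp.compMeasurePreservingₗᵢ ℂ (fun x : ℝ => x - a) (measurePreserving_sub_right volume a)

/-- The exponential function `E_a (x) = e^{2 π i a x}`. -/
def expFun (a x : ℝ) : ℂ := Complex.exp (2 * Real.pi * Complex.I * a * x)

theorem norm_expFun (a x : ℝ) : ‖expFun a x‖ = 1 := by
  have h : (2 * Real.pi * Complex.I * a * x : ℂ)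
      = ((2 * Real.pi * a * x : ℝ) : ℂ) * Complex.I := by
    push_cast
    ring
  rw [expFun, h, Complex.norm_exp_ofReal_mul_I]

theorem continuous_expFun (a : ℝ) : Continuous (expFun a) := by
  unfold expFun
  fun_prop

theorem memLp_modulation (a : ℝ) (f : L2R) :
    MemLp (fun x : ℝ => expFun a x * f x) 2 volume := by
  refine (Lp.memLp f).of_le
    ((continuous_expFun a).aestronglyMeasurable.mul (Lp.aestronglyMeasurable f)) ?_
  refine Eventually.of_forall fun x => ?_
  simp [norm_expFun]

/-- Modulation `E_a f (x) = e^{2 π i a x} f (x)` on `L²(ℝ)`. -/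
def modulation (a : ℝ) (f : L2R) : L2R := (memLp_modulation a f).toLp _

/-- The element `E_{mb} T_{na} g` of the Weyl-Heisenberg system `(g, a, b)`; `p = (m, n)`. -/
def atom (g : L2R) (a b : ℝ) (p : ℤ × ℤ) : L2R :=
  modulation (p.1 * b) (translation (p.2 * a) g)

/-- `G_k (t) = ∑_n g (t - n a) * conj (g (t - n a - k / b))`. -/
def corr (g : L2R) (a b : ℝ) (k : ℤ) (t : ℝ) : ℂ :=
  ∑' n : ℤ, g (t - n * a) * conj (g (t - n * a - k / b))

/-- `G_0 (t) = ∑_n |g (t - n a)|²`, a sum of nonnegative terms in `[0, ∞]`. -/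
def corrZero (g : L2R) (a t : ℝ) : ℝ≥0∞ :=
  ∑' n : ℤ, ‖g (t - n * a)‖ₑ ^ 2

/-- `G_0 (t) ≤ B` for almost every `t`. -/
def CorrZeroLE (g : L2R) (a B : ℝ) : Prop :=
  ∀ᵐ t : ℝ, corrZero g a t ≤ ENNReal.ofReal B

theorem mul_conj_bound {B : ℝ} {u v : ℤ → ℂ}
    (hu : ∑' n, ‖u n‖ₑ ^ 2 ≤ ENNReal.ofReal B) (hv : ∑' n, ‖v n‖ₑ ^ 2 ≤ ENNReal.ofReal B) :
    Summable (fun n => u n * conj (v n)) ∧ ‖∑' n, u n * conj (v n)‖ ≤ max B 0 := by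
  have key : ∀ w : ℤ → ℂ, ∑' n, ‖w n‖ₑ ^ 2 ≤ ENNReal.ofReal B →
      Summable (fun n => ‖w n‖ ^ 2) ∧ ∑' n, ‖w n‖ ^ 2 ≤ max B 0 := by
    intro w hw
    have e : ∀ n, ENNReal.ofReal (‖w n‖ ^ 2) = ‖w n‖ₑ ^ 2 := fun n => by
      rw [ENNReal.ofReal_pow (norm_nonneg _), ofReal_norm]
    have hs : Summable (fun n => ‖w n‖ ^ 2) := by
      have := ENNReal.summable_toReal (ne_top_of_le_ne_top ENNReal.ofReal_ne_top hw)
      simpa using this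
    refine ⟨hs, ?_⟩
    have h2 := ENNReal.ofReal_tsum_of_nonneg (fun n => sq_nonneg ‖w n‖) hs
    simp_rw [e] at h2
    rw [← h2] at hw
    have h3 := ENNReal.toReal_mono ENNReal.ofReal_ne_top hw
    rwa [ENNReal.toReal_ofReal (tsum_nonneg fun n => sq_nonneg ‖w n‖),
      ENNReal.toReal_ofReal'] at h3
  obtain ⟨su, bu⟩ := key u hu
  obtain ⟨sv, bv⟩ := key v hv
  have sm : Summable (fun n => (‖u n‖ ^ 2 + ‖v n‖ ^ 2) / 2) := (su.add sv).div_const 2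
  have le : ∀ n, ‖u n * conj (v n)‖ ≤ (‖u n‖ ^ 2 + ‖v n‖ ^ 2) / 2 := fun n => by
    rw [norm_mul, RCLike.norm_conj]
    nlinarith [sq_nonneg (‖u n‖ - ‖v n‖)]
  refine ⟨Summable.of_norm_bounded sm le, (tsum_of_norm_bounded sm.hasSum le).trans ?_⟩
  rw [tsum_div_const, su.tsum_add sv]
  linarith

theorem aestronglyMeasurable_shift (g : L2R) (c : ℝ) :
    AEStronglyMeasurable (fun t : ℝ => g (t - c)) volume :=
  (Lp.aestronglyMeasurable g).comp_measurePreserving (measurePreserving_sub_right volume c)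

theorem corr_spec {g : L2R} {a B : ℝ} (hB : CorrZeroLE g a B) (b : ℝ) (k : ℤ) :
    ∀ᵐ t : ℝ, Summable (fun n : ℤ => g (t - n * a) * conj (g (t - n * a - k / b))) ∧
      ‖corr g a b k t‖ ≤ max B 0 := by
  have h2 := (measurePreserving_sub_right (volume : Measure ℝ) ((k : ℝ) / b)
    ).quasiMeasurePreserving.ae hB
  filter_upwards [hB, h2] with t h1 h2
  refine mul_conj_bound h1 ?_
  have e : ∀ n : ℤ, t - n * a - k / b = t - k / b - n * a := fun n => by ring
  simp_rw [e]
  exact h2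

theorem aestronglyMeasurable_corr {g : L2R} {a B : ℝ} (hB : CorrZeroLE g a B) (b : ℝ) (k : ℤ) :
    AEStronglyMeasurable (corr g a b k) volume := by
  refine aestronglyMeasurable_of_tendsto_ae (u := (atTop : Filter (Finset ℤ)))
    (f := fun s t => ∑ n ∈ s, g (t - n * a) * conj (g (t - n * a - k / b))) ?_ ?_
  · intro s
    refine Finset.aestronglyMeasurable_fun_sum s fun n _ => ?_
    have h := aestronglyMeasurable_shift g (n * a + k / b)
    simp_rw [← sub_sub] at h
    exact (aestronglyMeasurable_shift g (n * a)).mul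
      (Complex.continuous_conj.comp_aestronglyMeasurable h)
  · filter_upwards [corr_spec hB b k] with t ht
    exact ht.1.hasSum

theorem memLp_walnut {g : L2R} {a B : ℝ} (hB : CorrZeroLE g a B) (b : ℝ) (K : ℕ) (f : L2R) :
    MemLp (fun t : ℝ => ∑ k ∈ Finset.Icc (-(K : ℤ)) K, f (t - k / b) * corr g a b k t)
      2 volume := by
  refine memLp_finsetSum _ fun k _ => ?_
  have hf : MemLp (fun t : ℝ => f (t - k / b)) 2 volume :=
    (Lp.memLp f).comp_measurePreserving (measurePreserving_sub_right volume ((k : ℝ) / b))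
  refine hf.of_le_mul (c := max B 0)
    (hf.aestronglyMeasurable.mul (aestronglyMeasurable_corr hB b k)) ?_
  filter_upwards [corr_spec hB b k] with t ht
  rw [norm_mul, mul_comm]
  exact mul_le_mul_of_nonneg_right ht.2 (norm_nonneg _)

/-- The symmetric partial sum `S_K f (t) = ∑_{k = -K}^{K} f (t - k / b) * G_k (t)` of the Walnut
series, as an element of `L²(ℝ)`. -/
def walnutSum {g : L2R} {a B : ℝ} (hB : CorrZeroLE g a B) (b : ℝ) (K : ℕ) (f : L2R) : L2R :=
  (memLp_walnut hB b K f).toLp _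

/-- `h = S f`, where `S f = ∑_{m,n} ⟨f, E_{mb} T_{na} g⟩ E_{mb} T_{na} g`: the series converges
unconditionally in `L²(ℝ)` with sum `h`. Mathlib's inner product is conjugate-linear in its
first argument, so `⟨f, h⟩` (linear in `f`) is `inner ℂ h f`. -/
def IsFrameOpValue (g : L2R) (a b : ℝ) (f h : L2R) : Prop :=
  HasSum (fun p : ℤ × ℤ => (inner ℂ (atom g a b p) f : ℂ) • atom g a b p) h

end WHFrame

end

/-! Each $G_k$ is bounded, so the $S_K$ are bounded operators. Two facts hold on a dense class, the
bounded functions $f$ of compact support. The first is the frame identity with a finite right-hand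
side (`hasSum_sq_inner_atom`): for fixed $n$, Parseval for the $1/b$-periodization of
$f\,\overline{g(\cdot-na)}$ sums over $m$, and summing over $n$ rebuilds $G_k$. The second is that
$S_Kf$ converges as soon as $\sup_K\|S_K\|<\infty$ (`exists_tendsto_walnutOp`): if $f$ lives on one
period interval, the Walnut terms have disjoint supports, so they form an orthogonal series with
bounded partial sums.

Everything else is uniform boundedness. Given (1), the norms $\|S_K\|$ are bounded, so the identity
on the dense class yields a Bessel bound; hence $S$ exists and is continuous, and the two quadratic
forms agree by density. Pairing $Sf$ with $f$ gives (3). Given (3), the quadratic forms of $S_K$ are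
pointwise bounded, so by polarization $\sup_K\|S_K\|<\infty$, and convergence spreads from the dense
class. -/

namespace WHFrame

/-! ### Operator sequences, orthogonal series and Bessel families in Hilbert space -/

section Hilbert

variable {E : Type*} [NormedAddCommGroup E] [InnerProductSpace ℂ E]

/-- A sequence of operators whose quadratic forms are pointwise bounded is norm bounded. -/
theorem exists_norm_le_of_quadratic_bounded [CompleteSpace E] (T : ℕ → E →L[ℂ] E)
    (h : ∀ f : E, ∃ C : ℝ, ∀ K, ‖(inner ℂ f (T K f) : ℂ)‖ ≤ C) : ∃ C : ℝ, ∀ K, ‖T K‖ ≤ C := by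
  refine banach_steinhaus fun y => ?_
  -- Polarization bounds the functionals $\langle T_Ky,\cdot\rangle$ pointwise. Uniform boundedness
  -- over $x$ then bounds $\|T_Ky\|$, and the outer application over $y$ bounds $\|T_K\|$.
  have weak : ∀ x : E, ∃ C : ℝ, ∀ K, ‖innerSL ℂ (T K y) x‖ ≤ C := by
    intro x
    have h' : ∀ f : E, ∃ C : ℝ, ∀ K, ‖(inner ℂ (T K f) f : ℂ)‖ ≤ C := fun f => by
      obtain ⟨C, hC⟩ := h f
      exact ⟨C, fun K => by rw [norm_inner_symm]; exact hC K⟩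
    obtain ⟨C₁, h₁⟩ := h' (x + y)
    obtain ⟨C₂, h₂⟩ := h' (x - y)
    obtain ⟨C₃, h₃⟩ := h' (x + Complex.I • y)
    obtain ⟨C₄, h₄⟩ := h' (x - Complex.I • y)
    refine ⟨(C₁ + C₂ + C₃ + C₄) / 4, fun K => ?_⟩
    have hp := inner_map_polarization (T K : E →ₗ[ℂ] E) x y
    simp only [ContinuousLinearMap.coe_coe] at hp
    rw [innerSL_apply_apply, hp, norm_div, show ‖(4 : ℂ)‖ = 4 by norm_num]
    gcongr
    refine (norm_sub_le _ _).trans (add_le_add ((norm_add_le _ _).trans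
      (add_le_add ((norm_sub_le _ _).trans (add_le_add (h₁ K) (h₂ K))) ?_)) ?_)
    · rw [norm_mul, Complex.norm_I, one_mul]
      exact h₃ K
    · rw [norm_mul, Complex.norm_I, one_mul]
      exact h₄ K
  obtain ⟨C, hC⟩ := banach_steinhaus weak
  exact ⟨C, fun K => by simpa using hC K⟩

/-- The symmetric partial sums of an orthogonal series converge as soon as they are bounded. -/
theorem exists_tendsto_sum_Icc_of_orthogonal [CompleteSpace E] {v : ℤ → E}
    (hv : Pairwise fun i j => (inner ℂ (v i) (v j) : ℂ) = 0) {C : ℝ}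
    (hC : ∀ K : ℕ, ‖∑ k ∈ Finset.Icc (-(K : ℤ)) K, v k‖ ≤ C) :
    ∃ h : E, Tendsto (fun K : ℕ => ∑ k ∈ Finset.Icc (-(K : ℤ)) K, v k) atTop (𝓝 h) := by
  have ho : OrthogonalFamily ℂ (fun i => ↥(Submodule.span ℂ {v i}))
      fun i => (Submodule.span ℂ {v i}).subtypeₗᵢ := by
    refine OrthogonalFamily.of_pairwise fun i j hij => Submodule.isOrtho_span.2 ?_
    rintro _ rfl _ rfl
    exact hv hij
  let w : ∀ i, ↥(Submodule.span ℂ {v i}) := fun i => ⟨v i, Submodule.mem_span_singleton_self _⟩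
  have hsq : ∀ s : Finset ℤ, ‖∑ k ∈ s, v k‖ ^ 2 = ∑ k ∈ s, ‖v k‖ ^ 2 := fun s => ho.norm_sum w s
  have hlim : Tendsto (fun K : ℕ => Finset.Icc (-(K : ℤ)) K) atTop atTop :=
    Finset.tendsto_Icc_neg_atTop_atTop.comp tendsto_natCast_atTop_atTop
  -- Every finite set lies in a symmetric interval, where Pythagoras turns the bound $C$ into $C^2$
  -- for the sum of squares.
  have hsum : Summable fun k => ‖v k‖ ^ 2 := by
    refine summable_of_sum_le (c := C ^ 2) (fun k => sq_nonneg _) fun s => ?_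
    obtain ⟨K, hK⟩ := (hlim.eventually_ge_atTop s).exists
    calc ∑ k ∈ s, ‖v k‖ ^ 2 ≤ ∑ k ∈ Finset.Icc (-(K : ℤ)) K, ‖v k‖ ^ 2 :=
          Finset.sum_le_sum_of_subset_of_nonneg hK fun _ _ _ => sq_nonneg _
      _ = ‖∑ k ∈ Finset.Icc (-(K : ℤ)) K, v k‖ ^ 2 := (hsq _).symm
      _ ≤ C ^ 2 := by gcongr; exact hC K
  have hs : Summable v := (ho.summable_iff_norm_sq_summable w).2 hsum
  exact ⟨_, hs.hasSum.comp hlim⟩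

/-- A norm bounded sequence of operators converging pointwise on a dense set converges
pointwise everywhere. -/
theorem exists_tendsto_of_dense [CompleteSpace E] {T : ℕ → E →L[ℂ] E} {C : ℝ} (hC : ∀ K, ‖T K‖ ≤ C) {D : Set E}
    (hD : Dense D) (h : ∀ f ∈ D, ∃ y, Tendsto (fun K => T K f) atTop (𝓝 y)) (f : E) :
    ∃ y, Tendsto (fun K => T K f) atTop (𝓝 y) := by
  have hC0 : 0 ≤ C := (norm_nonneg _).trans (hC 0)
  refine cauchySeq_tendsto_of_complete (Metric.cauchySeq_iff'.2 fun ε hε => ?_)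
  -- $C+1$ rather than $C$ keeps the denominator positive when $C=0$.
  obtain ⟨d, hd, hfd⟩ := Metric.dense_iff.1 hD f (ε / (3 * (C + 1))) (by positivity)
  rw [Metric.mem_ball, dist_comm, dist_eq_norm] at hd
  obtain ⟨y, hy⟩ := h d hfd
  obtain ⟨N, hN⟩ := Metric.cauchySeq_iff'.1 hy.cauchySeq (ε / 3) (by positivity)
  have hT : ∀ K, ‖T K f - T K d‖ < ε / 3 := fun K => by
    rw [← map_sub]
    calc ‖T K (f - d)‖ ≤ C * ‖f - d‖ := (T K).le_of_opNorm_le (hC K) _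
      _ ≤ (C + 1) * ‖f - d‖ := by gcongr; linarith
      _ < (C + 1) * (ε / (3 * (C + 1))) := by gcongr
      _ = ε / 3 := by field_simp
  refine ⟨N, fun n hn => ?_⟩
  have e : T n f - T N f = (T n f - T n d) + (T n d - T N d) - (T N f - T N d) := by abel
  have h2 := hN n hn
  rw [dist_eq_norm] at h2 ⊢
  rw [e]
  calc _ ≤ ‖T n f - T n d‖ + ‖T n d - T N d‖ + ‖T N f - T N d‖ :=
        (norm_sub_le _ _).trans (by gcongr; exact norm_add_le _ _)
    _ < ε / 3 + ε / 3 + ε / 3 := by gcongr <;> apply hT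
    _ = ε := by ring

variable {ι : Type*} {e : ι → E} {C : ℝ}

/-- A Bessel bound extends from a dense set. -/
theorem bessel_of_dense {D : Set E} (hD : Dense D)
    (h : ∀ f ∈ D, ∀ s : Finset ι, ∑ i ∈ s, ‖(inner ℂ (e i) f : ℂ)‖ ^ 2 ≤ C * ‖f‖ ^ 2) (f : E)
    (s : Finset ι) : ∑ i ∈ s, ‖(inner ℂ (e i) f : ℂ)‖ ^ 2 ≤ C * ‖f‖ ^ 2 := by
  have hc : IsClosed {f : E | ∑ i ∈ s, ‖(inner ℂ (e i) f : ℂ)‖ ^ 2 ≤ C * ‖f‖ ^ 2} :=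
    isClosed_le (by fun_prop) (by fun_prop)
  exact closure_minimal (fun f hf => h f hf s) hc (hD f)

/-- The frame series of a Bessel family converges unconditionally. -/
theorem summable_of_bessel [CompleteSpace E]
    (h : ∀ (f : E) (s : Finset ι), ∑ i ∈ s, ‖(inner ℂ (e i) f : ℂ)‖ ^ 2 ≤ C * ‖f‖ ^ 2) (f : E) :
    Summable fun i => (inner ℂ (e i) f : ℂ) • e i := by
  -- Expand $\|v\|^2$, apply Cauchy–Schwarz, then the Bessel bound to $v$ itself: $\|v\|^4\le
  -- A\,C\,\|v\|^2$, and cancel $\|v\|^2$.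
  have syn : ∀ s : Finset ι, ‖∑ i ∈ s, (inner ℂ (e i) f : ℂ) • e i‖ ^ 2
      ≤ C * ∑ i ∈ s, ‖(inner ℂ (e i) f : ℂ)‖ ^ 2 := by
    intro s
    set v := ∑ i ∈ s, (inner ℂ (e i) f : ℂ) • e i with hv
    set A := ∑ i ∈ s, ‖(inner ℂ (e i) f : ℂ)‖ ^ 2
    have hA : 0 ≤ A := Finset.sum_nonneg fun _ _ => sq_nonneg _
    have h1 : ‖v‖ ^ 2 ≤ ∑ i ∈ s, ‖(inner ℂ (e i) f : ℂ)‖ * ‖(inner ℂ (e i) v : ℂ)‖ := by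
      have : ((‖v‖ ^ 2 : ℝ) : ℂ) = ∑ i ∈ s, inner ℂ (e i) f * inner ℂ v (e i) := by
        have hvv : ((‖v‖ ^ 2 : ℝ) : ℂ) = inner ℂ v v := by
          rw [inner_self_eq_norm_sq_to_K]
          norm_cast
        rw [hvv]
        nth_rw 2 [hv]
        simp only [inner_sum, inner_smul_right]
      calc ‖v‖ ^ 2 = ‖((‖v‖ ^ 2 : ℝ) : ℂ)‖ := by simp
        _ ≤ _ := by
          rw [this]
          refine (norm_sum_le _ _).trans (Finset.sum_le_sum fun i _ => ?_)
          rw [norm_mul, norm_inner_symm v]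
    have h2 := Finset.sum_mul_sq_le_sq_mul_sq s (fun i => ‖(inner ℂ (e i) f : ℂ)‖)
      fun i => ‖(inner ℂ (e i) v : ℂ)‖
    have h3 : (‖v‖ ^ 2) ^ 2 ≤ A * (C * ‖v‖ ^ 2) :=
      (pow_le_pow_left₀ (sq_nonneg _) h1 2).trans (h2.trans (by gcongr; exact h v s))
    -- Nothing can be cancelled when $v=0$. If moreover $C<0$, the Bessel bound for $f$ forces
    -- $A=0$.
    rcases (sq_nonneg ‖v‖).eq_or_lt with h0 | h0
    · rw [← h0]
      rcases le_or_gt 0 C with hC | hC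
      · positivity
      · have := h f s
        have hA0 : A ≤ 0 := this.trans (mul_nonpos_of_nonpos_of_nonneg hC.le (sq_nonneg _))
        rw [le_antisymm hA0 hA, mul_zero]
    · nlinarith
  have hs : Summable fun i => ‖(inner ℂ (e i) f : ℂ)‖ ^ 2 :=
    summable_of_sum_le (fun _ => sq_nonneg _) (h f)
  refine summable_iff_vanishing_norm.2 fun ε hε => ?_
  obtain ⟨s, hs⟩ := summable_iff_vanishing_norm.1 hs (ε ^ 2 / (|C| + 1)) (by positivity)
  refine ⟨s, fun t ht => ?_⟩
  have h1 := (Real.norm_of_nonneg (Finset.sum_nonneg fun i _ => sq_nonneg _)).symm.trans_lt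
    (hs t ht)
  rw [lt_div_iff₀ (by positivity)] at h1
  refine lt_of_pow_lt_pow_left₀ 2 hε.le ((syn t).trans_lt (lt_of_le_of_lt ?_ h1))
  rw [mul_comm]
  have := le_abs_self C
  exact mul_le_mul_of_nonneg_left (by linarith) (Finset.sum_nonneg fun _ _ => sq_nonneg _)

/-- The quadratic form of the frame operator. -/
theorem hasSum_sq_of_hasSum {f h : E} (hh : HasSum (fun i => (inner ℂ (e i) f : ℂ) • e i) h) :
    Summable (fun i => ‖(inner ℂ (e i) f : ℂ)‖ ^ 2) ∧
      inner ℂ f h = ((∑' i, ‖(inner ℂ (e i) f : ℂ)‖ ^ 2 : ℝ) : ℂ) := by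
  have h1 : HasSum (fun i => ((‖(inner ℂ (e i) f : ℂ)‖ ^ 2 : ℝ) : ℂ)) (inner ℂ f h) := by
    have h2 := hh.mapL (innerSL ℂ f)
    rw [innerSL_apply_apply] at h2
    refine h2.congr_fun fun i => ?_
    rw [innerSL_apply_apply, inner_smul_right, ← inner_conj_symm f, Complex.mul_conj,
      Complex.normSq_eq_norm_sq]
  refine ⟨Complex.summable_ofReal.1 h1.summable, ?_⟩
  rw [Complex.ofReal_tsum, h1.tsum_eq]

end Hilbert

/-! ### Periodization and Parseval's identity -/

section Periodization

theorem expFun_add_div {b : ℝ} (hb : 0 < b) (m j : ℤ) (t : ℝ) :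
    expFun (m * b) (t + j / b) = expFun (m * b) t := by
  have hb' : (b : ℂ) ≠ 0 := by exact_mod_cast hb.ne'
  unfold expFun
  rw [Complex.exp_eq_exp_iff_exists_int]
  refine ⟨m * j, ?_⟩
  push_cast
  field_simp

/-- The integral over the line as a sum over the translates of a period interval. -/
theorem hasSum_setIntegral_add_div {b : ℝ} (hb : 0 < b) {h : ℝ → ℂ} (hh : Integrable h) :
    HasSum (fun j : ℤ => ∫ t in Set.Ioc 0 (1 / b), h (t + j / b)) (∫ t, h t) := by
  have hp : 0 < 1 / b := by positivity
  have key := hasSum_integral_iUnion (μ := volume) (f := h)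
    (s := fun n : ℤ => Set.Ioc (n • (1 / b)) ((n + 1) • (1 / b))) (fun _ => measurableSet_Ioc)
    (Set.pairwise_disjoint_Ioc_zsmul (1 / b)) hh.integrableOn
  rw [iUnion_Ioc_zsmul hp, Measure.restrict_univ] at key
  refine key.congr_fun fun j => ?_
  have := (measurePreserving_add_right (volume : Measure ℝ) ((j : ℝ) / b)).setIntegral_preimage_emb
    (measurableEmbedding_addRight _) h (Set.Ioc (j • (1 / b)) ((j + 1) • (1 / b)))
  rw [← this, Set.preimage_add_const_Ioc]
  congr 3
  · simp [div_eq_mul_inv]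
  · simp only [zsmul_eq_mul]
    push_cast
    ring

/-- This confines periodizations to $|j|\le N$. On the left, the interval's length $1/b$ costs one
step, which integrality, $j+1\le -N$, repays. -/
theorem add_div_notMem {b : ℝ} (hb : 0 < b) {N : ℕ} {t : ℝ} (ht : t ∈ Set.Ioc 0 (1 / b)) {j : ℤ}
    (hj : j ∉ Finset.Icc (-(N : ℤ)) N) : N / b ≤ |t + j / b| := by
  rw [Finset.mem_Icc, not_and_or, not_le, not_le] at hj
  obtain ⟨h0, h1⟩ := ht
  rcases hj with hj | hj
  · have hj' : (j : ℝ) + 1 ≤ -N := by exact_mod_cast hj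
    have : (j + 1) / b ≤ -N / b := by gcongr
    rw [add_div, neg_div] at this
    rw [abs_of_nonpos] <;> [skip; (have : 0 ≤ N / b := by positivity)] <;> linarith
  · have hj' : (N : ℝ) ≤ j := by exact_mod_cast hj.le
    have : N / b ≤ j / b := by gcongr
    exact le_abs.2 (Or.inl (by linarith))

theorem integral_eq_sum_setIntegral {b : ℝ} (hb : 0 < b) {h : ℝ → ℂ} (hh : Integrable h) {N : ℕ}
    (hN : ∀ t, N / b ≤ |t| → h t = 0) :
    ∫ t, h t = ∑ j ∈ Finset.Icc (-(N : ℤ)) N, ∫ t in Set.Ioc 0 (1 / b), h (t + j / b) := by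
  refine (hasSum_setIntegral_add_div hb hh).unique (hasSum_sum_of_ne_finset_zero fun j hj => ?_)
  exact setIntegral_eq_zero_of_forall_eq_zero fun t ht => hN _ (add_div_notMem hb ht hj)

theorem integrable_of_memLp_of_support {F : ℝ → ℂ} (hF : MemLp F 2) {R : ℝ}
    (hR : ∀ t, R ≤ |t| → F t = 0) : Integrable F := by
  have hs : Function.support F ⊆ Set.Icc (-R) R := fun t ht => by
    by_contra hc
    refine ht (hR t ?_)
    rw [Set.mem_Icc, ← abs_le] at hc
    exact (not_le.1 hc).le
  rw [← integrableOn_iff_integrable_of_support_subset hs]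
  exact (hF.restrict (Set.Icc (-R) R)).integrable (by norm_num)

/-- Parseval's identity for the periodization of a compactly supported function. -/
theorem hasSum_sq_integral_expFun {b : ℝ} (hb : 0 < b) {F : ℝ → ℂ} (hF : MemLp F 2) {N K : ℕ}
    (hN : ∀ t, N / b ≤ |t| → F t = 0) (hK : 2 * N ≤ K) :
    HasSum (fun m : ℤ => ((‖∫ t, conj (expFun (m * b) t) * F t‖ ^ 2 : ℝ) : ℂ))
      ((1 / b : ℂ) * ∑ k ∈ Finset.Icc (-(K : ℤ)) K, ∫ t, conj (F t) * F (t - k / b)) := by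
  have hp : 0 < 1 / b := by positivity
  have hbC : (b : ℂ) ≠ 0 := by exact_mod_cast hb.ne'
  have hFs : ∀ c : ℝ, MemLp (fun t => F (t + c)) 2 := fun c =>
    hF.comp_measurePreserving (measurePreserving_add_right volume c)
  have hFm : ∀ c : ℝ, MemLp (fun t => F (t - c)) 2 := fun c =>
    hF.comp_measurePreserving (measurePreserving_sub_right volume c)
  have hint := integrable_of_memLp_of_support hF hN
  -- On $(0,1/b]$ this finite sum is the full periodization of $F$.
  set P : ℝ → ℂ := fun t => ∑ j ∈ Finset.Icc (-(N : ℤ)) N, F (t + j / b) with hPdef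
  have hP : MemLp P 2 := memLp_finsetSum _ fun j _ => hFs _
  have coeff : ∀ m : ℤ, ∫ t, conj (expFun (m * b) t) * F t
      = ∫ t in Set.Ioc 0 (1 / b), conj (expFun (m * b) t) * P t := by
    intro m
    have hE : ∀ h : ℝ → ℂ, Integrable h → Integrable fun t => conj (expFun (m * b) t) * h t :=
      fun h hh => hh.bdd_mul (c := 1)
        (Complex.continuous_conj.comp (continuous_expFun _)).aestronglyMeasurable
        (Eventually.of_forall fun t => by rw [RCLike.norm_conj, norm_expFun])
    rw [integral_eq_sum_setIntegral hb (hE F hint) (N := N)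
      (fun t ht => by rw [hN t ht, mul_zero])]
    simp_rw [expFun_add_div hb, hPdef, Finset.mul_sum]
    rw [integral_finsetSum]
    exact fun j _ => (hE _ (hint.comp_add_right _)).integrableOn
  have pars := hasSum_sq_fourierCoeffOn hp (f := P) (hP.restrict _)
  have e1 : ∀ m : ℤ, fourierCoeffOn hp P m = (b : ℂ) * ∫ t, conj (expFun (m * b) t) * F t := by
    intro m
    rw [fourierCoeffOn_eq_integral, coeff, intervalIntegral.integral_of_le hp.le, sub_zero,
      one_div_one_div, Complex.real_smul]
    congr 2 with t
    rw [fourier_coe_apply, smul_eq_mul, expFun, ← Complex.exp_conj]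
    congr 2
    simp only [map_mul, Complex.conj_ofReal, Complex.conj_I, map_ofNat]
    push_cast
    field_simp
  have e2 : HasSum (fun m : ℤ => ((‖∫ t, conj (expFun (m * b) t) * F t‖ ^ 2 : ℝ) : ℂ))
      ((1 / b * ∫ t in Set.Ioc 0 (1 / b), ‖P t‖ ^ 2 : ℝ) : ℂ) := by
    rw [Complex.hasSum_ofReal]
    simp_rw [e1, norm_mul, mul_pow] at pars
    -- The Fourier coefficients carry a factor $b$, the inverse period; dividing by $b^2$ leaves
    -- $1/b$ in front of the integral.
    have := pars.mul_left ((1 / b) ^ 2)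
    rw [intervalIntegral.integral_of_le hp.le, smul_eq_mul, sub_zero] at this
    have e : (1 / b) ^ 2 * ((1 / b)⁻¹ * ∫ t in Set.Ioc 0 (1 / b), ‖P t‖ ^ 2)
        = 1 / b * ∫ t in Set.Ioc 0 (1 / b), ‖P t‖ ^ 2 := by
      field_simp
    rw [e] at this
    refine this.congr_fun fun m => ?_
    rw [Complex.norm_real, Real.norm_of_nonneg hb.le]
    field_simp
  convert e2 using 1
  push_cast
  congr 1
  set Q : ℝ → ℂ := fun t => ∑ k ∈ Finset.Icc (-(K : ℤ)) K, F (t - k / b) with hQdef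
  have hQ : MemLp Q 2 := memLp_finsetSum _ fun j _ => hFm _
  have hconj : MemLp (fun t => conj (F t)) 2 := hF.star
  have hconjs : ∀ c : ℝ, MemLp (fun t => conj (F (t + c))) 2 := fun c => (hFs c).star
  -- For $|j|\le N$ and $K\ge 2N$ the window $[j-K,j+K]$ contains $[-N,N]$, so the truncation at $K$
  -- loses nothing.
  have hPQ : ∀ t ∈ Set.Ioc 0 (1 / b), ∀ j ∈ Finset.Icc (-(N : ℤ)) N, Q (t + j / b) = P t := by
    intro t ht j hj
    have hj' := Finset.mem_Icc.1 hj
    have hz : ∀ l : ℤ, l ∉ Finset.Icc (-(N : ℤ)) N → F (t + l / b) = 0 :=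
      fun l hl => hN _ (add_div_notMem hb ht hl)
    have : Q (t + j / b) = ∑ l ∈ Finset.Icc (j - K) (j + K), F (t + l / b) := by
      refine Finset.sum_nbij' (fun k => j - k) (fun l => j - l) ?_ ?_ ?_ ?_ ?_
      · intro k hk; rw [Finset.mem_Icc] at hk ⊢; omega
      · intro k hk; rw [Finset.mem_Icc] at hk ⊢; omega
      · intro k _; ring
      · intro k _; ring
      · intro k _; congr 1; push_cast; ring
    rw [this]
    refine (Finset.sum_subset (fun l hl => ?_) fun l _ hl => hz l hl).symm
    rw [Finset.mem_Icc] at hl ⊢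
    omega
  calc ∑ k ∈ Finset.Icc (-(K : ℤ)) K, ∫ t, conj (F t) * F (t - k / b)
      = ∫ t, conj (F t) * Q t := by
        simp_rw [hQdef, Finset.mul_sum]
        rw [integral_finsetSum]
        exact fun k _ => hconj.integrable_mul (hFm _)
    _ = ∑ j ∈ Finset.Icc (-(N : ℤ)) N,
          ∫ t in Set.Ioc 0 (1 / b), conj (F (t + j / b)) * Q (t + j / b) :=
        integral_eq_sum_setIntegral hb (hconj.integrable_mul hQ)
          fun t ht => by simp [hN t ht]
    _ = ∑ j ∈ Finset.Icc (-(N : ℤ)) N, ∫ t in Set.Ioc 0 (1 / b), conj (F (t + j / b)) * P t := by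
        refine Finset.sum_congr rfl fun j hj => setIntegral_congr_fun measurableSet_Ioc
          fun t ht => ?_
        simp only [hPQ t ht j hj]
    _ = ∫ t in Set.Ioc 0 (1 / b), conj (P t) * P t := by
        have hi : ∀ j : ℤ, IntegrableOn (fun t => conj (F (t + j / b)) * P t)
            (Set.Ioc 0 (1 / b)) := fun j => ((hconjs _).integrable_mul hP).integrableOn
        rw [← integral_finsetSum _ fun j _ => hi j]
        refine integral_congr_ae (Eventually.of_forall fun t => ?_)
        simp only [hPdef, map_sum, Finset.sum_mul]
    _ = _ := by
        rw [← integral_complex_ofReal]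
        refine integral_congr_ae (Eventually.of_forall fun t => ?_)
        simp only [RCLike.conj_mul]
        norm_cast

end Periodization

end WHFrame

/-! ### Walnut terms as bounded operators -/

noncomputable section

namespace WHFrame

theorem coeFn_translation (c : ℝ) (f : L2R) : translation c f =ᵐ[volume] fun t => f (t - c) :=
  Lp.coeFn_compMeasurePreserving f (measurePreserving_sub_right volume c)

theorem coeFn_atom (g : L2R) (a b : ℝ) (p : ℤ × ℤ) :
    atom g a b p =ᵐ[volume] fun t => expFun (p.1 * b) t * g (t - p.2 * a) := by
  filter_upwards [(memLp_modulation (p.1 * b) (translation (p.2 * a) g)).coeFn_toLp,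
    coeFn_translation (p.2 * a) g] with t h1 h2
  rw [atom, modulation, h1, h2]

theorem inner_atom (g : L2R) (a b : ℝ) (p : ℤ × ℤ) (f : L2R) :
    inner ℂ (atom g a b p) f
      = ∫ t, conj (expFun (p.1 * b) t) * (f t * conj (g (t - p.2 * a))) := by
  rw [L2.inner_def]
  refine integral_congr_ae ?_
  filter_upwards [coeFn_atom g a b p] with t ht
  rw [ht, RCLike.inner_apply, map_mul]
  ring

section Walnut

variable {g : L2R} {a B : ℝ} (hB : CorrZeroLE g a B) (b : ℝ) (k : ℤ)

theorem memLp_walnutTerm {g : L2R} {a B : ℝ} (hB : CorrZeroLE g a B) (b : ℝ) (k : ℤ) (f : L2R) :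
    MemLp (fun t => f (t - k / b) * corr g a b k t) 2 volume := by
  have hf : MemLp (fun t : ℝ => f (t - k / b)) 2 volume :=
    (Lp.memLp f).comp_measurePreserving (measurePreserving_sub_right volume ((k : ℝ) / b))
  refine hf.of_le_mul (c := max B 0)
    (hf.aestronglyMeasurable.mul (aestronglyMeasurable_corr hB b k)) ?_
  filter_upwards [corr_spec hB b k] with t ht
  rw [norm_mul, mul_comm]
  exact mul_le_mul_of_nonneg_right ht.2 (norm_nonneg _)

theorem ae_comp_sub_const {p : ℝ → Prop} (h : ∀ᵐ t, p t) (c : ℝ) : ∀ᵐ t : ℝ, p (t - c) :=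
  (measurePreserving_sub_right (volume : Measure ℝ) c).quasiMeasurePreserving.ae h

/-- The term `f ↦ f (· - k / b) G_k` of the Walnut series, as a bounded operator. -/
def walnutTerm : L2R →L[ℂ] L2R :=
  LinearMap.mkContinuous
    { toFun := fun f => (memLp_walnutTerm hB b k f).toLp _
      map_add' := fun f h => by
        rw [← MemLp.toLp_add]
        refine MemLp.toLp_congr _ _ ?_
        filter_upwards [ae_comp_sub_const (Lp.coeFn_add f h) (k / b)] with t ht
        simp only [ht, Pi.add_apply, add_mul]
      map_smul' := fun c f => by
        rw [RingHom.id_apply, ← MemLp.toLp_const_smul]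
        refine MemLp.toLp_congr _ _ ?_
        filter_upwards [ae_comp_sub_const (Lp.coeFn_smul c f) (k / b)] with t ht
        simp only [ht, Pi.smul_apply, smul_eq_mul, mul_assoc] }
    (max B 0) fun f => by
      -- Translation is isometric, so both sides can be compared at the same point $t$.
      rw [← (translation (k / b)).norm_map f]
      refine Lp.norm_le_mul_norm_of_ae_le_mul ?_
      filter_upwards [corr_spec hB b k, (memLp_walnutTerm hB b k f).coeFn_toLp,
        coeFn_translation (k / b) f] with t h1 h2 h3
      rw [LinearMap.coe_mk, AddHom.coe_mk, h2, h3, norm_mul, mul_comm]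
      exact mul_le_mul_of_nonneg_right h1.2 (norm_nonneg _)

theorem coeFn_walnutTerm (f : L2R) :
    walnutTerm hB b k f =ᵐ[volume] fun t => f (t - k / b) * corr g a b k t :=
  (memLp_walnutTerm hB b k f).coeFn_toLp

/-- The symmetric partial sums of the Walnut series, as bounded operators. -/
def walnutOp (K : ℕ) : L2R →L[ℂ] L2R := ∑ k ∈ Finset.Icc (-(K : ℤ)) K, walnutTerm hB b k

theorem walnutSum_eq (K : ℕ) (f : L2R) : walnutSum hB b K f = walnutOp hB b K f := by
  refine Lp.ext ((memLp_walnut hB b K f).coeFn_toLp.trans ?_)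
  rw [walnutOp, sum_apply]
  filter_upwards [Lp.coeFn_finsetSum (Finset.Icc (-(K : ℤ)) K) fun k => walnutTerm hB b k f,
    ae_all_iff.2 fun k => coeFn_walnutTerm hB b k f] with t h1 h2
  rw [h1, Finset.sum_apply]
  simp only [h2]

theorem inner_walnutTerm (f h : L2R) :
    inner ℂ h (walnutTerm hB b k f) = ∫ t, conj (h t) * f (t - k / b) * corr g a b k t := by
  rw [L2.inner_def]
  refine integral_congr_ae ?_
  filter_upwards [coeFn_walnutTerm hB b k f] with t ht
  rw [ht, RCLike.inner_apply]
  ring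

theorem inner_walnutOp (K : ℕ) (f : L2R) : inner ℂ f (walnutOp hB b K f)
    = ∑ k ∈ Finset.Icc (-(K : ℤ)) K, ∫ t, conj (f t) * f (t - k / b) * corr g a b k t := by
  rw [walnutOp, sum_apply, inner_sum]
  exact Finset.sum_congr rfl fun k _ => inner_walnutTerm hB b k f f

end Walnut

/-! ### The frame identity for bounded functions of compact support -/

theorem tsum_enorm_mul_le {ι : Type*} (u v : ι → ℂ) :
    ∑' n, ‖u n * conj (v n)‖ₑ ≤ ∑' n, ‖u n‖ₑ ^ 2 + ∑' n, ‖v n‖ₑ ^ 2 := by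
  rw [← ENNReal.tsum_add]
  refine ENNReal.tsum_le_tsum fun n => ?_
  rw [enorm_mul, RCLike.enorm_conj]
  rcases le_total ‖u n‖ₑ ‖v n‖ₑ with h | h
  · exact le_add_left ((mul_le_mul_left h _).trans (sq _).ge)
  · exact le_add_right ((mul_le_mul_right h _).trans (sq _).ge)

theorem hasSum_integral_of_tsum_lintegral_ne_top {ι : Type*} [Countable ι] {H : ι → ℝ → ℂ}
    (hH : ∀ i, Integrable (H i)) (h : ∫⁻ t, ∑' i, ‖H i t‖ₑ ≠ ∞) :
    HasSum (fun i => ∫ t, H i t) (∫ t, ∑' i, H i t) := by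
  refine hasSum_integral_of_summable_integral_norm hH ?_
  rw [lintegral_tsum fun i => (hH i).aestronglyMeasurable.enorm] at h
  refine (ENNReal.summable_toReal h).congr fun i => ?_
  rw [integral_norm_eq_lintegral_enorm (hH i).aestronglyMeasurable]

theorem hasSum_prod_of_nonneg {α β : Type*} {f : α × β → ℝ} (hf : 0 ≤ f) {r : α → ℂ} {v : ℂ}
    (h1 : ∀ x, HasSum (fun y => (f (x, y) : ℂ)) (r x)) (h2 : HasSum r v) :
    HasSum (fun p => (f p : ℂ)) v := by
  have hs : ∀ x, Summable fun y => f (x, y) := fun x => Complex.summable_ofReal.1 (h1 x).summable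
  have hr : r = fun x => ((∑' y, f (x, y) : ℝ) : ℂ) := by
    funext x
    rw [Complex.ofReal_tsum, (h1 x).tsum_eq]
  rw [hr] at h2
  have hsum : Summable f :=
    (summable_prod_of_nonneg hf).2 ⟨hs, Complex.summable_ofReal.1 h2.summable⟩
  have h3 := (Complex.hasSum_ofReal.2 hsum.hasSum)
  have h4 := Complex.hasSum_ofReal.2 (hsum.hasSum.prod_fiberwise fun x => (hs x).hasSum)
  rwa [h4.unique h2] at h3

theorem memLp_mul_conj_shift {f : ℝ → ℂ} (hf : MemLp f 2) {M : ℝ} (hM : ∀ t, ‖f t‖ ≤ M) (g : L2R)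
    (c : ℝ) : MemLp (fun t => f t * conj (g (t - c))) 2 := by
  have hg : MemLp (fun t => g (t - c)) 2 volume :=
    (Lp.memLp g).comp_measurePreserving (measurePreserving_sub_right volume c)
  refine hg.of_le_mul (c := M) (hf.aestronglyMeasurable.mul hg.star.aestronglyMeasurable)
    (Eventually.of_forall fun t => ?_)
  rw [norm_mul, RCLike.norm_conj]
  exact mul_le_mul_of_nonneg_right (hM t) (norm_nonneg _)

/-- Sum and integral commute because the series is dominated by $2\max(B,0)\,|f(t)f(t-k/b)|$, which
is integrable. Boundedness of $f$ puts $f\,\overline{g(\cdot-na)}$ in $L^2$. -/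
theorem hasSum_integral_corr {g : L2R} {a B : ℝ} (hB : CorrZeroLE g a B) (b : ℝ) (k : ℤ)
    {f : ℝ → ℂ} (hf : MemLp f 2) {M : ℝ} (hM : ∀ t, ‖f t‖ ≤ M) :
    HasSum (fun n : ℤ => ∫ t, conj (f t * conj (g (t - n * a)))
        * (f (t - k / b) * conj (g (t - k / b - n * a))))
      (∫ t, conj (f t) * f (t - k / b) * corr g a b k t) := by
  have hfk : MemLp (fun t => f (t - k / b)) 2 :=
    hf.comp_measurePreserving (measurePreserving_sub_right volume ((k : ℝ) / b))
  have hff : Integrable fun t => conj (f t) * f (t - k / b) := hf.star.integrable_mul hfk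
  have hF : ∀ n : ℤ, MemLp (fun t => f t * conj (g (t - n * a))) 2 :=
    fun n => memLp_mul_conj_shift hf hM g _
  have e : ∀ (n : ℤ) (t : ℝ), conj (f t * conj (g (t - n * a)))
      * (f (t - k / b) * conj (g (t - k / b - n * a)))
      = conj (f t) * f (t - k / b) * (g (t - n * a) * conj (g (t - k / b - n * a))) := by
    intro n t
    rw [map_mul, Complex.conj_conj]
    ring
  have key := hasSum_integral_of_tsum_lintegral_ne_top (H := fun (n : ℤ) t =>
      conj (f t * conj (g (t - n * a))) * (f (t - k / b) * conj (g (t - k / b - n * a))))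
    (fun n => (hF n).star.integrable_mul ((hF n).comp_measurePreserving
      (measurePreserving_sub_right volume ((k : ℝ) / b)))) ?_
  · simp only [e, tsum_mul_left] at key ⊢
    simpa only [corr, sub_right_comm] using key
  · have hBt : ENNReal.ofReal B + ENNReal.ofReal B ≠ ∞ := by finiteness
    refine ne_top_of_le_ne_top (ENNReal.mul_ne_top hff.hasFiniteIntegral.ne hBt) ?_
    rw [← lintegral_mul_const' _ _ hBt]
    refine lintegral_mono_ae ?_
    filter_upwards [hB, ae_comp_sub_const hB (k / b)] with t h1 h2
    simp only [e, enorm_mul (conj (f t) * f (t - k / b)), ENNReal.tsum_mul_left]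
    gcongr
    exact (tsum_enorm_mul_le _ _).trans (add_le_add h1 h2)

/-- The frame identity for bounded functions of compact support. -/
theorem hasSum_sq_inner_atom {g : L2R} {a b B : ℝ} (hb : 0 < b) (hB : CorrZeroLE g a B)
    {f : ℝ → ℂ} (hf : MemLp f 2) {M : ℝ} (hM : ∀ t, ‖f t‖ ≤ M) {N K : ℕ}
    (hN : ∀ t, N / b ≤ |t| → f t = 0) (hK : 2 * N ≤ K) :
    HasSum (fun p : ℤ × ℤ => ((‖(inner ℂ (atom g a b p) (hf.toLp f) : ℂ)‖ ^ 2 : ℝ) : ℂ))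
      ((1 / b : ℂ) * inner ℂ (hf.toLp f) (walnutOp hB b K (hf.toLp f))) := by
  have hae := hf.coeFn_toLp
  have e1 : ∀ p : ℤ × ℤ, inner ℂ (atom g a b p) (hf.toLp f)
      = ∫ t, conj (expFun (p.1 * b) t) * (f t * conj (g (t - p.2 * a))) := fun p => by
    rw [inner_atom]
    refine integral_congr_ae ?_
    filter_upwards [hae] with t ht
    rw [ht]
  have e2 : ∀ k : ℤ, ∫ t, conj (hf.toLp f t) * hf.toLp f (t - k / b) * corr g a b k t
      = ∫ t, conj (f t) * f (t - k / b) * corr g a b k t := fun k => by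
    refine integral_congr_ae ?_
    filter_upwards [hae, ae_comp_sub_const hae (k / b)] with t h1 h2
    rw [h1, h2]
  simp_rw [inner_walnutOp, e1, e2]
  -- The swap makes $m$ the inner index, where Parseval applies for fixed $n$.
  rw [← (Equiv.prodComm ℤ ℤ).hasSum_iff]
  refine hasSum_prod_of_nonneg (f := (fun p : ℤ × ℤ => ‖∫ t, conj (expFun (p.1 * b) t)
    * (f t * conj (g (t - p.2 * a)))‖ ^ 2) ∘ Equiv.prodComm ℤ ℤ) (fun _ => sq_nonneg _)
    (fun n => hasSum_sq_integral_expFun hb (memLp_mul_conj_shift hf hM g (n * a))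
      (fun t ht => by rw [hN t ht, zero_mul]) hK) ?_
  exact (hasSum_sum fun k _ => hasSum_integral_corr hB b k hf hM).mul_left _

/-! ### The dense class and convergence of the Walnut series on it -/

/-- The classes of the bounded functions that vanish outside `(-N / b, N / b)` for some `N`. -/
def boundedCompact (b : ℝ) : Set L2R :=
  {F | ∃ (f : ℝ → ℂ) (hf : MemLp f 2 volume) (M : ℝ) (N : ℕ), (∀ t, ‖f t‖ ≤ M) ∧
    (∀ t, N / b ≤ |t| → f t = 0) ∧ F = hf.toLp f}

theorem dense_boundedCompact {b : ℝ} (hb : 0 < b) : Dense (boundedCompact b) := by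
  refine EMetric.dense_iff.2 fun F ε hε => ?_
  obtain ⟨δ, hδ, hδε⟩ := exists_between hε
  obtain ⟨f, hfs, hfδ, hfc, hf⟩ :=
    (Lp.memLp F).exists_hasCompactSupport_eLpNorm_sub_le ENNReal.ofNat_ne_top hδ.ne'
  refine ⟨hf.toLp f, ?_, f, hf, ?_⟩
  · rw [Metric.mem_eball, edist_comm]
    nth_rw 1 [← Lp.toLp_coeFn F (Lp.memLp F)]
    rw [Lp.edist_toLp_toLp]
    exact hfδ.trans_lt hδε
  · obtain ⟨M, hM⟩ := hfs.exists_bound_of_continuous hfc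
    obtain ⟨R, hR⟩ := hfs.isCompact.isBounded.subset_closedBall 0
    obtain ⟨N, hN⟩ := exists_nat_gt (R * b)
    refine ⟨M, N, hM, fun t ht => ?_, rfl⟩
    by_contra h0
    have h1 := hR (subset_tsupport f h0)
    rw [mem_closedBall_zero_iff, Real.norm_eq_abs] at h1
    rw [div_le_iff₀ hb] at ht
    nlinarith

/-- The translates of one period interval by multiples of $1/b$ are disjoint, so the Walnut terms
are orthogonal whatever the $G_k$ are; their partial sums are bounded by $C\|f\|$. -/
theorem exists_tendsto_walnutOp_of_period {g : L2R} {a b B : ℝ} (hb : 0 < b)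
    (hB : CorrZeroLE g a B) {C : ℝ} (hC : ∀ K, ‖walnutOp hB b K‖ ≤ C) {f : ℝ → ℂ}
    (hf : MemLp f 2) (j : ℤ) (hj : ∀ t, t - j / b ∉ Set.Ioc 0 (1 / b) → f t = 0) :
    ∃ h, Tendsto (fun K => walnutOp hB b K (hf.toLp f)) atTop (𝓝 h) := by
  have ho : Pairwise fun k l : ℤ =>
      (inner ℂ (walnutTerm hB b k (hf.toLp f)) (walnutTerm hB b l (hf.toLp f)) : ℂ) = 0 := by
    intro k l hkl
    rw [L2.inner_def]
    refine integral_eq_zero_of_ae ?_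
    filter_upwards [coeFn_walnutTerm hB b k (hf.toLp f), coeFn_walnutTerm hB b l (hf.toLp f),
      ae_comp_sub_const hf.coeFn_toLp (k / b), ae_comp_sub_const hf.coeFn_toLp (l / b)]
      with t h1 h2 h3 h4
    rw [h1, h2, h3, h4, RCLike.inner_apply]
    by_cases hk : t - k / b - j / b ∈ Set.Ioc 0 (1 / b)
    · have hl : t - l / b - j / b ∉ Set.Ioc 0 (1 / b) := by
        intro hl
        have e : ∀ m : ℤ, t - m / b - j / b = t - (m + j) • (1 / b) := fun m => by
          rw [zsmul_eq_mul]
          push_cast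
          ring
        rw [e] at hk hl
        have hu := (existsUnique_sub_zsmul_mem_Ioc (by positivity : 0 < 1 / b) t 0).unique
          (y₁ := k + j) (y₂ := l + j) (by rwa [zero_add]) (by rwa [zero_add])
        omega
      simp [hj _ hl]
    · simp [hj _ hk]
  obtain ⟨h, hh⟩ := exists_tendsto_sum_Icc_of_orthogonal ho (C := C * ‖hf.toLp f‖) fun K => by
    rw [← sum_apply]
    exact (walnutOp hB b K).le_of_opNorm_le (hC K) _
  refine ⟨h, hh.congr fun K => ?_⟩
  rw [walnutOp, sum_apply]

/-- Cutting along period intervals leaves $2N+1$ pieces, each covered by the one-period case. -/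
theorem exists_tendsto_walnutOp {g : L2R} {a b B : ℝ} (hb : 0 < b)
    (hB : CorrZeroLE g a B) {C : ℝ} (hC : ∀ K, ‖walnutOp hB b K‖ ≤ C) {F : L2R}
    (hF : F ∈ boundedCompact b) :
    ∃ h, Tendsto (fun K => walnutOp hB b K F) atTop (𝓝 h) := by
  obtain ⟨f, hf, -, N, -, hN, rfl⟩ := hF
  let I : ℤ → Set ℝ := fun j => {t | t - j / b ∈ Set.Ioc 0 (1 / b)}
  have hI : ∀ j, MeasurableSet (I j) := fun j =>
    measurableSet_Ioc.preimage (measurable_id.sub_const _)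
  have hp : ∀ j, MemLp ((I j).indicator f) 2 := fun j => hf.indicator (hI j)
  have hsum : hf.toLp f = ∑ j ∈ Finset.Icc (-(N : ℤ)) N, (hp j).toLp _ := by
    refine Lp.ext ?_
    filter_upwards [hf.coeFn_toLp, ae_all_iff.2 fun j => (hp j).coeFn_toLp,
      Lp.coeFn_finsetSum (Finset.Icc (-(N : ℤ)) N) fun j => (hp j).toLp _] with t h1 h2 h3
    rw [h1, h3, Finset.sum_apply]
    simp only [h2]
    obtain ⟨i, hi, hu⟩ := existsUnique_sub_zsmul_mem_Ioc (by positivity : 0 < 1 / b) t 0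
    have e : ∀ m : ℤ, t ∈ I m ↔ t - m • (1 / b) ∈ Set.Ioc 0 (0 + 1 / b) := fun m => by
      rw [zero_add, zsmul_eq_mul, mul_one_div]
      rfl
    rw [Finset.sum_eq_single i, Set.indicator_of_mem ((e i).2 hi)]
    · exact fun j _ hji => Set.indicator_of_notMem (fun hj => hji (hu j ((e j).1 hj))) _
    · intro hiN
      rw [Set.indicator_of_mem ((e i).2 hi)]
      have := add_div_notMem hb ((e i).2 hi) hiN
      rw [sub_add_cancel] at this
      exact hN t this
  choose h hh using fun j => exists_tendsto_walnutOp_of_period hb hB hC (hp j) j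
    fun t ht => Set.indicator_of_notMem (s := I j) ht f
  refine ⟨∑ j ∈ Finset.Icc (-(N : ℤ)) N, h j, ?_⟩
  simp only [hsum, map_sum]
  exact tendsto_finsetSum _ fun j _ => hh j

/-! ### From the dense class to all of $L^2$ -/

theorem exists_hasSum_sq_inner_atom {g : L2R} {a b B : ℝ} (hb : 0 < b) (hB : CorrZeroLE g a B)
    {F : L2R} (hF : F ∈ boundedCompact b) : ∃ K₀ : ℕ, ∀ K ≥ K₀,
      HasSum (fun p : ℤ × ℤ => ((‖(inner ℂ (atom g a b p) F : ℂ)‖ ^ 2 : ℝ) : ℂ))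
        ((1 / b : ℂ) * inner ℂ F (walnutOp hB b K F)) := by
  obtain ⟨f, hf, M, N, hM, hN, rfl⟩ := hF
  exact ⟨2 * N, fun K hK => hasSum_sq_inner_atom hb hB hf hM hN hK⟩

/-- On the dense class the sum of squares equals $b^{-1}\langle S_KF,F\rangle$ for a single large
$K$, hence is at most $b^{-1}C\|F\|^2$. -/
theorem bessel_of_norm_walnutOp_le {g : L2R} {a b B : ℝ} (hb : 0 < b) (hB : CorrZeroLE g a B)
    {C : ℝ} (hC : ∀ K, ‖walnutOp hB b K‖ ≤ C) (F : L2R) (s : Finset (ℤ × ℤ)) :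
    ∑ p ∈ s, ‖(inner ℂ (atom g a b p) F : ℂ)‖ ^ 2 ≤ 1 / b * C * ‖F‖ ^ 2 := by
  refine bessel_of_dense (dense_boundedCompact hb) (fun F hF s => ?_) F s
  obtain ⟨K, hK⟩ := exists_hasSum_sq_inner_atom hb hB hF
  have h1 := hK K le_rfl
  have h2 := Complex.summable_ofReal.1 h1.summable
  calc _ ≤ ∑' p : ℤ × ℤ, ‖(inner ℂ (atom g a b p) F : ℂ)‖ ^ 2 :=
        h2.sum_le_tsum s fun _ _ => sq_nonneg _
    _ = ‖(1 / b : ℂ) * inner ℂ F (walnutOp hB b K F)‖ := by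
        rw [← h1.tsum_eq, ← Complex.ofReal_tsum, Complex.norm_real,
          Real.norm_of_nonneg (tsum_nonneg fun _ => sq_nonneg _)]
    _ ≤ 1 / b * (‖F‖ * (C * ‖F‖)) := by
        rw [norm_mul, norm_div, norm_one, Complex.norm_real, Real.norm_of_nonneg hb.le]
        gcongr
        exact (norm_inner_le_norm _ _).trans (by
          gcongr
          exact (walnutOp hB b K).le_of_opNorm_le (hC K) _)
    _ = _ := by ring

theorem frameOp_of_tendsto_walnutOp {g : L2R} {a b B : ℝ} (hb : 0 < b) (hB : CorrZeroLE g a B)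
    (h : ∀ f, ∃ y, Tendsto (fun K => walnutOp hB b K f) atTop (𝓝 y)) (f : L2R) :
    ∃ Sf, IsFrameOpValue g a b f Sf ∧
      Tendsto (fun K => (1 / b : ℂ) * inner ℂ f (walnutOp hB b K f)) atTop
        (𝓝 (inner ℂ f Sf)) := by
  choose W hW using h
  obtain ⟨C, hC⟩ : ∃ C : ℝ, ∀ K, ‖walnutOp hB b K‖ ≤ C := banach_steinhaus fun f => by
    obtain ⟨C, hC⟩ := (hW f).norm.bddAbove_range
    exact ⟨C, fun K => hC ⟨K, rfl⟩⟩
  have hS : ∀ f, Summable fun p => (inner ℂ (atom g a b p) f : ℂ) • atom g a b p :=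
    summable_of_bessel (bessel_of_norm_walnutOp_le hb hB hC)
  have hWc : Continuous W :=
    (continuousLinearMapOfTendsto (fun K => walnutOp hB b K) (tendsto_pi_nhds.2 hW)).continuous
  let S : L2R → L2R := fun f => ∑' p, (inner ℂ (atom g a b p) f : ℂ) • atom g a b p
  -- $S$ is a pointwise limit of finite-rank operators, hence continuous by Banach–Steinhaus.
  have hSc : Continuous S := by
    let A : Finset (ℤ × ℤ) → L2R →L[ℂ] L2R := fun s =>
      ∑ p ∈ s, (innerSL ℂ (atom g a b p)).smulRight (atom g a b p)
    refine (continuousLinearMapOfTendsto A (l := atTop) (f := S)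
      (tendsto_pi_nhds.2 fun f => (hS f).hasSum.congr fun s => ?_)).continuous
    simp [A]
  have hT : ∀ f, Tendsto (fun K => (1 / b : ℂ) * inner ℂ f (walnutOp hB b K f)) atTop
      (𝓝 ((1 / b : ℂ) * inner ℂ f (W f))) := fun f =>
    (tendsto_const_nhds.inner (hW f)).const_mul _
  -- Both forms are continuous. On the dense class the left one is the limit of an eventually
  -- constant sequence whose value is the sum of squares.
  have heq : (fun f => (1 / b : ℂ) * inner ℂ f (W f)) = fun f => inner ℂ f (S f) := by
    refine Continuous.ext_on (dense_boundedCompact hb) (by fun_prop) (by fun_prop) fun F hF => ?_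
    obtain ⟨K₀, hK⟩ := exists_hasSum_sq_inner_atom hb hB hF
    refine tendsto_nhds_unique (hT F) (tendsto_const_nhds.congr' ?_)
    filter_upwards [eventually_ge_atTop K₀] with K hKK
    rw [(hasSum_sq_of_hasSum (hS F).hasSum).2, Complex.ofReal_tsum, (hK K hKK).tsum_eq]
  refine ⟨S f, (hS f).hasSum, ?_⟩
  rw [← congrFun heq f]
  exact hT f

end WHFrame

end

theorem mainTheorem4 (a b B : ℝ) (hb : 0 < b) (g : WHFrame.L2R)
    (hB : WHFrame.CorrZeroLE g a B) :
    List.TFAE [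
      -- the Walnut series converges symmetrically in norm, for every `f`
      ∀ f : WHFrame.L2R, ∃ h : WHFrame.L2R,
        Tendsto (fun K : ℕ => WHFrame.walnutSum hB b K f) atTop (𝓝 h),
      -- `S f` exists and `b⁻¹ ⟨S_K f, f⟩ → ⟨S f, f⟩`, for every `f`
      ∀ f : WHFrame.L2R, ∃ Sf : WHFrame.L2R, WHFrame.IsFrameOpValue g a b f Sf ∧
        Tendsto (fun K : ℕ => (1 / b : ℂ) * inner ℂ f (WHFrame.walnutSum hB b K f)) atTop
          (𝓝 (inner ℂ f Sf)),
      -- the frame identity holds for every `f`, the right side being summed symmetrically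
      ∀ f : WHFrame.L2R,
        Summable (fun p : ℤ × ℤ => ‖(inner ℂ (WHFrame.atom g a b p) f : ℂ)‖ ^ 2) ∧
        Tendsto (fun K : ℕ => (1 / b : ℂ) * ∑ k ∈ Finset.Icc (-(K : ℤ)) K,
            ∫ t : ℝ, conj (f t) * f (t - k / b) * WHFrame.corr g a b k t) atTop
          (𝓝 ((∑' p : ℤ × ℤ, ‖(inner ℂ (WHFrame.atom g a b p) f : ℂ)‖ ^ 2 : ℝ) : ℂ))] := by
  simp only [WHFrame.walnutSum_eq, ← WHFrame.inner_walnutOp hB]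
  tfae_have 1 → 2 := WHFrame.frameOp_of_tendsto_walnutOp hb hB
  tfae_have 2 → 3 := fun h f => by
    obtain ⟨Sf, hS, hT⟩ := h f
    obtain ⟨h1, h2⟩ := WHFrame.hasSum_sq_of_hasSum hS
    exact ⟨h1, h2 ▸ hT⟩
  tfae_have 3 → 1 := fun h => by
    have hbC : (b : ℂ) ≠ 0 := by exact_mod_cast hb.ne'
    obtain ⟨C, hC⟩ := WHFrame.exists_norm_le_of_quadratic_bounded
      (fun K => WHFrame.walnutOp hB b K) fun f => by
        -- A convergent sequence is bounded; the factor $b$ cancels $1/b$.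
        obtain ⟨C, hC⟩ := ((h f).2.const_mul (b : ℂ)).norm.bddAbove_range
        refine ⟨C, fun K => ?_⟩
        have := hC ⟨K, rfl⟩
        beta_reduce at this
        rwa [← mul_assoc, mul_one_div_cancel hbC, one_mul] at this
    exact WHFrame.exists_tendsto_of_dense hC (WHFrame.dense_boundedCompact hb)
      fun F hF => WHFrame.exists_tendsto_walnutOp hb hB hC hF
  tfae_finish
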